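/- Let $k$ be an algebraically closed field of characteristic zero and let $G$ be a finite group. Let $H = k^G$ be the Hopf algebra of functions $G \to k$ with pointwise multiplication, with basis $e_x$ ($x \in G$), $e_x(y) = \delta_{x,y}$, comultiplication $\Delta(e_x) = \sum_{x_1x_2 = x} e_{x_1} \otimes e_{x_2}$ and counit $\epsilon(e_x) = \delta_{x,1}$. We use Sweedler notation $\Delta(a) = a_1 \otimes a_2$, and $*$ denotes the convolution product. A lazy $2$-cocycle on $k^G$ is a convolution invertible $k$-linear map $\alpha : H \otimes H \to k$ such that, for all $a,b,c \in H$, * $\alpha(1,a) = \epsilon(a) = \alpha(a,1)$, * $\alpha(a_1,b_1)\,\alpha(a_2b_2,c) = \alpha(b_1,c_1)\,\alpha(a,b_2c_2)$ (left $2$-cocycle), * $\alpha(a_1,b_1)\,a_2b_2 = a_1b_1\,\alpha(a_2,b_2)$ (lazy, i.e. $\alpha * \mu_H = \mu_H * \alpha$, where $\mu_H$ is the multiplication of $H$). Let $\alpha$ be a lazy $2$-cocycle on $k^G$ which is symmetric: $\alpha(e_g,e_h) = \alpha(e_h,e_g)$ for all $g,h \in G$. Then $\alpha$ is cohomologically trivial,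 i.e. its class in $\mathrm{H}^2(k^G)$ is trivial: there is a convolution invertible $k$-linear map $\eta : k^G \to k$ with $\eta(1) = 1$, and with convolution inverse $\eta^{-1}$, such that for all $a,b \in k^G$ $$\alpha(a,b) = \mathrm{d}\eta(a,b) := \eta(a_1)\,\eta(b_1)\,\eta^{-1}(a_2b_2).$$ (The map $\eta$ is not required to be lazy.) -/

import Mathlib

open scoped TensorProduct

section Cohomology

open LinearMap WithConv

variable (k H : Type*) [Field k] [Ring H] [Bialgebra k H]

/-- The convolution algebra of `k`-linear maps `H → k`, with unit the counit `ε` and product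
`(η * η')(a) = η(a₁) η'(a₂)`. -/
abbrev Conv1 := WithConv (H →ₗ[k] k)

/-- The convolution algebra of `k`-linear maps `H ⊗ H → k`, with unit `ε ⊗ ε` and product
`(σ * τ)(a ⊗ b) = σ(a₁ ⊗ b₁) τ(a₂ ⊗ b₂)`. -/
abbrev Conv2 := WithConv (H ⊗[k] H →ₗ[k] k)

/-- `Reg¹(H)`: convolution invertible linear maps `η : H → k` with `η(1) = 1`. -/
def Reg1 : Set (Conv1 k H)ˣ := {η | η.val 1 = 1}

/-- `Reg²(H)`: convolution invertible linear maps `σ : H ⊗ H → k` with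
`σ(1, h) = ε(h) = σ(h, 1)`. -/
def Reg2 : Set (Conv2 k H)ˣ :=
  {σ | ∀ h : H, σ.val (1 ⊗ₜ[k] h) = Coalgebra.counit (R := k) h ∧
    σ.val (h ⊗ₜ[k] 1) = Coalgebra.counit (R := k) h}

variable {k H}

/-- The left 2-cocycle identity `σ(a₁, b₁) σ(a₂b₂, c) = σ(b₁, c₁) σ(a, b₂c₂)`, written as an
identity of convolution products of linear maps `(H ⊗ H) ⊗ H → k`: the left side is the product of
`a ⊗ b ⊗ c ↦ σ(a, b) ε(c)` and `a ⊗ b ⊗ c ↦ σ(ab, c)`, the right side is the product of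
`a ⊗ b ⊗ c ↦ ε(a) σ(b, c)` and `a ⊗ b ⊗ c ↦ σ(a, bc)`. -/
def IsLeftCocycle (σ : Conv2 k H) : Prop :=
  (toConv (mul' k k ∘ₗ TensorProduct.map σ.ofConv Coalgebra.counit) *
      toConv (σ.ofConv ∘ₗ TensorProduct.map (mul' k H) LinearMap.id) :
      WithConv ((H ⊗[k] H) ⊗[k] H →ₗ[k] k)) =
    toConv (mul' k k ∘ₗ TensorProduct.map Coalgebra.counit σ.ofConv ∘ₗ
        (TensorProduct.assoc k H H H).toLinearMap) *
      toConv (σ.ofConv ∘ₗ TensorProduct.map LinearMap.id (mul' k H) ∘ₗ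
        (TensorProduct.assoc k H H H).toLinearMap)

variable (k H) in
/-- `Z²(H)`: the left 2-cocycles on `H`. -/
def Z2 : Set (Conv2 k H)ˣ := {σ | σ ∈ Reg2 k H ∧ IsLeftCocycle σ.val}

/-- `σ` is lazy if `σ * μ = μ * σ` in the convolution algebra of linear maps `H ⊗ H → H`, where
`μ` is the multiplication of `H`, that is, `σ(a₁, b₁) a₂b₂ = a₁b₁ σ(a₂, b₂)`. -/
def IsLazy (σ : Conv2 k H) : Prop :=
  (toConv (Algebra.linearMap k H ∘ₗ σ.ofConv) * toConv (mul' k H) :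
      WithConv (H ⊗[k] H →ₗ[k] H)) =
    toConv (mul' k H) * toConv (Algebra.linearMap k H ∘ₗ σ.ofConv)

variable (k H) in
/-- `Z²_L(H)`: the lazy left 2-cocycles on `H`. -/
def Z2Lazy : Set (Conv2 k H)ˣ := {σ | σ ∈ Z2 k H ∧ IsLazy σ.val}

/-- The coboundary `dη(a, b) = η(a₁) η(b₁) η⁻¹(a₂b₂)`, where `η⁻¹` is the convolution inverse. -/
noncomputable def coboundary (η : (Conv1 k H)ˣ) : Conv2 k H :=
  toConv (mul' k k ∘ₗ TensorProduct.map η.val.ofConv η.val.ofConv) *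
    toConv ((η⁻¹).val.ofConv ∘ₗ mul' k H)

/-- A 2-cocycle is cohomologically trivial (its class in `H²(H)`, the 2-cocycles modulo the image
of `d` on all of `Reg¹(H)`, is trivial) if it equals `dη` for some `η ∈ Reg¹(H)`. -/
def IsCohomologicallyTrivial (σ : (Conv2 k H)ˣ) : Prop :=
  ∃ η ∈ Reg1 k H, σ.val = coboundary η

end Cohomology

section FunctionAlgebra

/-- The underlying space of the dual group algebra `k^G`, the functions `G → k`. -/
def FunctionHopf (k G : Type*) : Type _ := G → k

namespace FunctionHopf

variable {k G : Type*} [Field k]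

/-- The ring structure on `k^G` is pointwise. -/
instance : CommRing (FunctionHopf k G) := inferInstanceAs (CommRing (G → k))

instance : Algebra k (FunctionHopf k G) := inferInstanceAs (Algebra k (G → k))

variable (k) in
/-- Evaluation at `x`. -/
def ev (x : G) : FunctionHopf k G →ₐ[k] k := Pi.evalAlgHom k (fun _ : G => k) x

theorem ext_ev {f g : FunctionHopf k G} (h : ∀ x, ev k x f = ev k x g) : f = g := funext h

variable (k) in
/-- Evaluation `f ⊗ g ↦ f(x) g(y)`. -/
noncomputable def ev2 (x y : G) : FunctionHopf k G ⊗[k] FunctionHopf k G →ₐ[k] k :=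
  (Algebra.TensorProduct.lmul' k).comp (Algebra.TensorProduct.map (ev k x) (ev k y))

theorem ev2_tmul (x y : G) (f g : FunctionHopf k G) :
    ev2 k x y (f ⊗ₜ[k] g) = ev k x f * ev k y g := by
  simp [ev2]

variable (k G) in
/-- The antipode `S(f)(x) = f(x⁻¹)`. -/
def antipodeMap [Group G] : FunctionHopf k G →ₗ[k] FunctionHopf k G :=
  LinearMap.funLeft k k (fun x : G => x⁻¹)

theorem ev_antipodeMap [Group G] (x : G) (f : FunctionHopf k G) :
    ev k x (antipodeMap k G f) = ev k x⁻¹ f := rfl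

variable [DecidableEq G]

/-- The basis vector `e_x` of `k^G`, with `e_x(y) = δ_{x,y}`. -/
def e (x : G) : FunctionHopf k G := (Pi.single x 1 : G → k)

theorem ev_e (x y : G) : ev k x (e y) = if x = y then (1 : k) else 0 :=
  Pi.single_apply (M := k) y 1 x

variable [Fintype G]

theorem sum_ev_smul_e (f : FunctionHopf k G) : ∑ x, ev k x f • e x = f := by
  apply ext_ev
  intro z
  simp [map_sum, ev_e]

theorem hom_ext {M : Type*} [AddCommMonoid M] [Module k M] {p q : FunctionHopf k G →ₗ[k] M}
    (h : ∀ z, p (e z) = q (e z)) : p = q := by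
  ext f
  rw [← sum_ev_smul_e f]
  simp [h]

theorem sum_ev2_smul (t : FunctionHopf k G ⊗[k] FunctionHopf k G) :
    ∑ x, ∑ y, ev2 k x y t • (e x ⊗ₜ[k] e y) = t := by
  induction t using TensorProduct.induction_on with
  | zero => simp
  | tmul f g =>
    conv_rhs => rw [← sum_ev_smul_e f, ← sum_ev_smul_e g]
    rw [TensorProduct.sum_tmul]
    simp only [ev2_tmul, TensorProduct.tmul_sum, TensorProduct.smul_tmul_smul]
  | add s t hs ht =>
    conv_rhs => rw [← hs, ← ht]
    simp [add_smul, Finset.sum_add_distrib]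

theorem ext_ev2 {s t : FunctionHopf k G ⊗[k] FunctionHopf k G}
    (h : ∀ x y, ev2 k x y s = ev2 k x y t) : s = t := by
  rw [← sum_ev2_smul s, ← sum_ev2_smul t]
  simp [h]

variable [Group G]

variable (k G) in
/-- The comultiplication of `k^G`: `Δ(f) = ∑_{x,y} f(xy) e_x ⊗ e_y`. -/
noncomputable def comulMap : FunctionHopf k G →ₗ[k] FunctionHopf k G ⊗[k] FunctionHopf k G :=
  ∑ x, ∑ y, (ev k (x * y)).toLinearMap.smulRight (e x ⊗ₜ[k] e y)

theorem comulMap_apply (f : FunctionHopf k G) :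
    comulMap k G f = ∑ x, ∑ y, ev k (x * y) f • (e x ⊗ₜ[k] e y) := by
  simp [comulMap, LinearMap.sum_apply]

theorem ev2_comulMap (x y : G) (f : FunctionHopf k G) :
    ev2 k x y (comulMap k G f) = ev k (x * y) f := by
  simp [comulMap_apply, ev2_tmul, ev_e]

theorem comulMap_e (z : G) :
    comulMap k G (e z) = ∑ x, e x ⊗ₜ[k] e (x⁻¹ * z) := by
  rw [comulMap_apply]
  refine Finset.sum_congr rfl fun x _ => ?_
  simp [ev_e, ← eq_inv_mul_iff_mul_eq]

/-- The coalgebra structure of `k^G`, with counit `ε(f) = f(1)`. -/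
noncomputable instance : Coalgebra k (FunctionHopf k G) where
  comul := comulMap k G
  counit := (ev k 1).toLinearMap
  coassoc := by
    apply hom_ext
    intro z
    simp only [LinearMap.comp_apply, comulMap_e, map_sum, LinearMap.rTensor_tmul,
      LinearMap.lTensor_tmul, TensorProduct.sum_tmul, TensorProduct.tmul_sum,
      LinearEquiv.coe_coe, TensorProduct.assoc_tmul]
    rw [Finset.sum_comm]
    refine Finset.sum_congr rfl fun x _ => ?_
    refine Fintype.sum_equiv (Equiv.mulLeft x⁻¹) _ _ fun y => ?_
    simp [mul_assoc]
  rTensor_counit_comp_comul := by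
    apply hom_ext
    intro z
    simp [comulMap_e, ev_e, TensorProduct.ite_tmul]
  lTensor_counit_comp_comul := by
    apply hom_ext
    intro z
    simp [comulMap_e, ev_e, TensorProduct.tmul_ite, eq_inv_mul_iff_mul_eq]

theorem comul_apply (f : FunctionHopf k G) :
    Coalgebra.comul (R := k) f = ∑ x, ∑ y, ev k (x * y) f • (e x ⊗ₜ[k] e y) :=
  comulMap_apply f

theorem counit_apply (f : FunctionHopf k G) : Coalgebra.counit (R := k) f = ev k 1 f := rfl

noncomputable instance : Bialgebra k (FunctionHopf k G) :=
  Bialgebra.mk' k (FunctionHopf k G) (map_one (ev k 1)) (fun {a b} => map_mul (ev k 1) a b)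
    (ext_ev2 fun x y => (ev2_comulMap x y 1).trans (by simp))
    (fun {a b} => ext_ev2 fun x y => (ev2_comulMap x y (a * b)).trans (by
      rw [map_mul, map_mul]
      exact congrArg₂ _ (ev2_comulMap x y a).symm (ev2_comulMap x y b).symm))

noncomputable instance : HopfAlgebra k (FunctionHopf k G) where
  antipode := antipodeMap k G
  mul_antipode_rTensor_comul := by
    ext f
    apply ext_ev
    intro x
    simp [comul_apply, counit_apply, ev_antipodeMap, ev_e]
  mul_antipode_lTensor_comul := by
    ext f
    apply ext_ev
    intro x
    simp [comul_apply, counit_apply, ev_antipodeMap, ev_e]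

end FunctionHopf

end FunctionAlgebra

/-!
A 2-cocycle `σ` on the commutative Hopf algebra `k^G` deforms the multiplication of `k^G` into
`f ·_σ g = σ(f₁, g₁) f₂ g₂`. The cocycle identity says that this product is associative, the
normalization of `σ` that `1` is still the unit, and for symmetric `σ` the product is commutative.
A nonzero finite-dimensional commutative algebra over an algebraically closed field has a character
`χ`, here `χ(f) χ(g) = χ(f ·_σ g) = σ(f₁, g₁) χ(f₂ g₂)`, that is, `χ ⊗ χ = σ * (χ ∘ μ)`
(`LinearMap.exists_character_of_comm_assoc`, `convMul_comp_mul'_tmul`). Such a `χ` is convolution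
invertible, because convolution by it is injective on a finite-dimensional algebra
(`isUnit_of_map_eq_convMul`), so that `σ = (χ ⊗ χ) * (χ⁻¹ ∘ μ) = dχ`.

Computations use the right translations `(R_z f)(x) = f(xz)`: the comultiplication is
`Δ(f) = ∑_z R_z f ⊗ e_z`, so the twisted product is `(f ·_σ g)(z) = σ(R_z f, R_z g)`. It commutes
with translations, which reduces its associativity to the identity
`σ(f ·_σ g, h) = σ(f, g ·_σ h)`, a form of the cocycle identity.
-/

/-! ### Characters and units of finite-dimensional algebras -/

theorem IsAlgClosed.nonempty_algHom_of_finite (k A : Type*) [Field k] [IsAlgClosed k]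
    [CommRing A] [Nontrivial A] [Algebra k A] [Module.Finite k A] : Nonempty (A →ₐ[k] k) := by
  obtain ⟨m, hm⟩ := Ideal.exists_maximal A
  let _ := Ideal.Quotient.field m
  have hb := IsAlgClosed.algebraMap_bijective_of_isIntegral (k := k) (K := A ⧸ m)
  exact ⟨(AlgEquiv.ofBijective (Algebra.ofId k (A ⧸ m)) hb).symm.toAlgHom.comp
    (Ideal.Quotient.mkₐ k m)⟩

/-- A commutative, associative, unital bilinear product on a nonzero finite-dimensional space over
an algebraically closed field has a character. The character is found on the algebra generated by
the multiplication operators, so that the product need not be installed as a ring structure. -/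
theorem LinearMap.exists_character_of_comm_assoc {k V : Type*} [Field k] [IsAlgClosed k]
    [AddCommGroup V] [Module k V] [Module.Finite k V] [Nontrivial V] (m : V →ₗ[k] V →ₗ[k] V)
    (u : V) (hone : ∀ a, m u a = a) (hcomm : ∀ a b, m a b = m b a)
    (hassoc : ∀ a b c, m (m a b) c = m a (m b c)) :
    ∃ χ : V →ₗ[k] k, χ u = 1 ∧ ∀ a b, χ (m a b) = χ a * χ b := by
  have hmul : ∀ a b, m (m a b) = (m a * m b : Module.End k V) := fun a b => by
    ext c; exact hassoc a b c
  let A := Algebra.adjoin k (Set.range (m : V → Module.End k V))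
  have hA : ∀ a, m a ∈ A := fun a => Algebra.subset_adjoin ⟨a, rfl⟩
  have : IsMulCommutative A := Algebra.isMulCommutative_adjoin k (by
    rintro _ ⟨a, rfl⟩ _ ⟨b, rfl⟩
    rw [← hmul, ← hmul, hcomm])
  let _ : CommRing A := { (inferInstance : Ring A) with mul_comm := mul_comm' }
  obtain ⟨φ⟩ := IsAlgClosed.nonempty_algHom_of_finite k A
  refine ⟨φ.toLinearMap ∘ₗ m.codRestrict (Subalgebra.toSubmodule A) hA, ?_, fun a b => ?_⟩
  · have : (⟨m u, hA u⟩ : A) = 1 := Subtype.ext (LinearMap.ext hone)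
    exact (congrArg φ this).trans (map_one φ)
  · have : (⟨m (m a b), hA _⟩ : A) = ⟨m a, hA a⟩ * ⟨m b, hA b⟩ := Subtype.ext (hmul a b)
    exact (congrArg φ this).trans (map_mul φ _ _)

theorem Algebra.isUnit_of_isLeftRegular {k A : Type*} [Field k] [Ring A] [Algebra k A]
    [Module.Finite k A] {a : A} (ha : IsLeftRegular a) : IsUnit a := by
  obtain ⟨b, hb⟩ := LinearMap.surjective_of_injective (f := LinearMap.mulLeft k a) ha 1
  have hb : a * b = 1 := hb
  exact ⟨⟨a, b, hb, ha (by simp [← mul_assoc, hb])⟩, rfl⟩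

/-! ### Right translations and convolution products on `k^G` -/

namespace FunctionHopf

open LinearMap WithConv

variable {k G : Type*} [Field k] [Group G]

variable (k) in
/-- Right translation `(R_z f)(x) = f(xz)`. -/
def translate (z : G) : FunctionHopf k G →ₗ[k] FunctionHopf k G :=
  LinearMap.funLeft k k (fun x : G => x * z)

theorem ev_translate (x z : G) (f : FunctionHopf k G) : ev k x (translate k z f) = ev k (x * z) f :=
  rfl

theorem translate_translate (x z : G) (f : FunctionHopf k G) :
    translate k x (translate k z f) = translate k (x * z) f :=
  ext_ev fun y => by simp [ev_translate, mul_assoc]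

theorem translate_one (z : G) : translate k z 1 = 1 := rfl

variable [DecidableEq G]

theorem translate_e (z x : G) : translate k z (e x) = e (x * z⁻¹) := by
  apply ext_ev
  intro y
  simp [ev_translate, ev_e, eq_mul_inv_iff_mul_eq]

omit [Group G] in
theorem e_mul_e (x y : G) : (e x * e y : FunctionHopf k G) = if x = y then e x else 0 := by
  apply ext_ev
  intro z
  by_cases h : x = y <;> by_cases h' : z = x <;> simp_all [ev_e]

variable [Fintype G]

/-- The comultiplication in terms of translations: `Δ(f) = ∑_z R_z f ⊗ e_z`. -/
noncomputable def translateRepr (f : FunctionHopf k G) : Coalgebra.Repr k f G where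
  index := Finset.univ
  left z := translate k z f
  right z := e z
  eq := ext_ev2 fun x y => by
    refine Eq.trans ?_ (ev2_comulMap x y f).symm
    simp [ev2_tmul, ev_translate, ev_e]

variable {A : Type*} [Ring A] [Algebra k A]

theorem convMul_apply (p q : WithConv (FunctionHopf k G →ₗ[k] A)) (f : FunctionHopf k G) :
    (p * q) f = ∑ z, p (translate k z f) * q (e z) :=
  (translateRepr f).convMul_apply p q

theorem convMul_tmul (p q : WithConv (FunctionHopf k G ⊗[k] FunctionHopf k G →ₗ[k] A))
    (f g : FunctionHopf k G) :
    (p * q) (f ⊗ₜ g) =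
      ∑ z, ∑ w, p (translate k z f ⊗ₜ translate k w g) * q (e z ⊗ₜ e w) :=
  (((translateRepr f).tmul (translateRepr g)).convMul_apply p q).trans
    (Finset.sum_product _ _ _)

theorem convMul_tmul_tmul
    (p q : WithConv ((FunctionHopf k G ⊗[k] FunctionHopf k G) ⊗[k] FunctionHopf k G →ₗ[k] A))
    (f g h : FunctionHopf k G) :
    (p * q) ((f ⊗ₜ g) ⊗ₜ h) =
      ∑ z, ∑ w, ∑ y, p ((translate k z f ⊗ₜ translate k w g) ⊗ₜ translate k y h) *
        q ((e z ⊗ₜ e w) ⊗ₜ e y) :=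
  ((((translateRepr f).tmul (translateRepr g)).tmul (translateRepr h)).convMul_apply p q).trans
    ((Finset.sum_product _ _ _).trans (Finset.sum_product _ _ _))

/-! ### The twisted product -/

/-- The twisted product `f ·_σ g = σ(f₁, g₁) f₂ g₂` on `k^G`, in pointwise form:
`(f ·_σ g)(z) = σ(R_z f, R_z g)`. -/
noncomputable def twistedMul (σ : Conv2 k (FunctionHopf k G)) :
    FunctionHopf k G →ₗ[k] FunctionHopf k G →ₗ[k] FunctionHopf k G :=
  LinearMap.mk₂ k (fun f g => (fun z => σ (translate k z f ⊗ₜ translate k z g) : G → k))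
    (fun f f' g => funext fun z => by
      rw [map_add, TensorProduct.add_tmul, map_add]; rfl)
    (fun c f g => funext fun z => by
      rw [map_smul, ← TensorProduct.smul_tmul', map_smul]; rfl)
    (fun f g g' => funext fun z => by
      rw [map_add, TensorProduct.tmul_add, map_add]; rfl)
    (fun c f g => funext fun z => by
      rw [map_smul, TensorProduct.tmul_smul, map_smul]; rfl)

variable {σ : Conv2 k (FunctionHopf k G)}

theorem ev_twistedMul (z : G) (f g : FunctionHopf k G) :
    ev k z (twistedMul σ f g) = σ (translate k z f ⊗ₜ translate k z g) := rfl

theorem twistedMul_eq_sum (f g : FunctionHopf k G) :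
    twistedMul σ f g = ∑ z, σ (translate k z f ⊗ₜ translate k z g) • e z :=
  (sum_ev_smul_e _).symm

theorem translate_twistedMul (z : G) (f g : FunctionHopf k G) :
    translate k z (twistedMul σ f g) = twistedMul σ (translate k z f) (translate k z g) := by
  apply ext_ev
  intro x
  simp only [ev_translate, ev_twistedMul, translate_translate]

theorem sum_counit_translate_smul_e (f : FunctionHopf k G) :
    ∑ z, Coalgebra.counit (R := k) (translate k z f) • e z = f := by
  conv_rhs => rw [← sum_ev_smul_e f]
  simp [counit_apply, ev_translate]

/-- Evaluated on `f ⊗ g ⊗ h`, the two sides of the cocycle identity are `σ(f ·_σ g, h)` and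
`σ(f, g ·_σ h)`. -/
theorem apply_twistedMul_tmul (hσ : IsLeftCocycle σ) (f g h : FunctionHopf k G) :
    σ (twistedMul σ f g ⊗ₜ h) = σ (f ⊗ₜ twistedMul σ g h) := by
  have key := congrArg (fun p => p ((f ⊗ₜ g) ⊗ₜ h)) hσ
  simp only [convMul_tmul_tmul, LinearMap.comp_apply, TensorProduct.map_tmul,
    mul'_apply, LinearMap.id_apply, LinearEquiv.coe_coe, TensorProduct.assoc_tmul, e_mul_e] at key
  have hl : σ (twistedMul σ f g ⊗ₜ h) = ∑ z, ∑ y, σ (translate k z f ⊗ₜ translate k z g) *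
      Coalgebra.counit (R := k) (translate k y h) * σ (e z ⊗ₜ e y) := by
    conv_lhs => rw [twistedMul_eq_sum, ← sum_counit_translate_smul_e h]
    simp [TensorProduct.sum_tmul, TensorProduct.tmul_sum, Finset.mul_sum, mul_assoc,
      mul_left_comm, ← TensorProduct.smul_tmul']
    exact Finset.sum_comm
  have hr : σ (f ⊗ₜ twistedMul σ g h) = ∑ z, ∑ w, Coalgebra.counit (R := k) (translate k z f) *
      σ (translate k w g ⊗ₜ translate k w h) * σ (e z ⊗ₜ e w) := by
    conv_lhs => rw [twistedMul_eq_sum, ← sum_counit_translate_smul_e f]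
    simp [TensorProduct.sum_tmul, TensorProduct.tmul_sum, Finset.mul_sum, mul_assoc,
      mul_left_comm, ← TensorProduct.smul_tmul']
    exact Finset.sum_comm
  rw [hl, hr]
  simpa [TensorProduct.ite_tmul, TensorProduct.tmul_ite, apply_ite σ.ofConv] using key

theorem twistedMul_assoc (hσ : IsLeftCocycle σ) (f g h : FunctionHopf k G) :
    twistedMul σ (twistedMul σ f g) h = twistedMul σ f (twistedMul σ g h) := by
  apply ext_ev
  intro z
  simp only [ev_twistedMul, translate_twistedMul, apply_twistedMul_tmul hσ]

theorem one_twistedMul (hσ : ∀ h, σ (1 ⊗ₜ[k] h) = Coalgebra.counit (R := k) h)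
    (f : FunctionHopf k G) : twistedMul σ 1 f = f := by
  apply ext_ev
  intro z
  rw [ev_twistedMul, translate_one, hσ, counit_apply, ev_translate, one_mul]

theorem twistedMul_comm (hσ : ∀ g h : G, σ (e g ⊗ₜ[k] e h) = σ (e h ⊗ₜ[k] e g))
    (f g : FunctionHopf k G) : twistedMul σ f g = twistedMul σ g f := by
  have hσ' : ∀ f g, σ (f ⊗ₜ g) = σ (g ⊗ₜ f) := by
    have : TensorProduct.curry σ.ofConv = (TensorProduct.curry σ.ofConv).flip :=
      hom_ext fun x => hom_ext fun y => hσ x y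
    exact fun f g => congr($this f g)
  exact ext_ev fun z => hσ' _ _

/-- A linear functional `χ` satisfies `χ(f ·_σ g) = χ(f) χ(g)` iff `χ ⊗ χ = σ * (χ ∘ μ)`; here is
the computation of the right-hand side. -/
theorem convMul_comp_mul'_tmul (χ : FunctionHopf k G →ₗ[k] k) (f g : FunctionHopf k G) :
    (σ * toConv (χ ∘ₗ mul' k (FunctionHopf k G))) (f ⊗ₜ g) = χ (twistedMul σ f g) := by
  rw [convMul_tmul, twistedMul_eq_sum, map_sum]
  simp [e_mul_e, apply_ite χ]

/-! ### Invertibility of the character and coboundaries -/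

theorem convMul_mul'_comp_map (a b c d : Conv1 k (FunctionHopf k G)) :
    (toConv (mul' k k ∘ₗ TensorProduct.map a.ofConv b.ofConv) *
      toConv (mul' k k ∘ₗ TensorProduct.map c.ofConv d.ofConv) : Conv2 k (FunctionHopf k G)) =
    toConv (mul' k k ∘ₗ TensorProduct.map (a * c).ofConv (b * d).ofConv) := by
  apply WithConv.ext
  ext f g
  simp [-LinearMap.convMul_apply, convMul_tmul, convMul_apply, Finset.sum_mul_sum, mul_mul_mul_comm]

instance : Module.Finite k (FunctionHopf k G) := inferInstanceAs (Module.Finite k (G → k))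

instance : Nontrivial (FunctionHopf k G) := inferInstanceAs (Nontrivial (G → k))

instance : Module.Finite k (Conv1 k (FunctionHopf k G)) :=
  Module.Finite.equiv (WithConv.linearEquiv k (FunctionHopf k G →ₗ[k] k)).symm

/-- If `χ ⊗ χ = σ * (χ ∘ μ)` with `σ` invertible and `χ * c = 0`, then
`(χ ∘ μ) * (c ⊗ ε) = σ⁻¹ * ((χ * c) ⊗ χ) = 0`. At `e_{xz} ⊗ e_x` this says `χ(e_x) c(e_z) = 0`, so
`c = 0` once `χ(e_x) ≠ 0`. -/
theorem isUnit_of_map_eq_convMul (σ : (Conv2 k (FunctionHopf k G))ˣ)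
    (χ : Conv1 k (FunctionHopf k G)) (hχ : χ ≠ 0)
    (h : toConv (mul' k k ∘ₗ TensorProduct.map χ.ofConv χ.ofConv) =
      σ.val * toConv (χ.ofConv ∘ₗ mul' k (FunctionHopf k G))) : IsUnit χ := by
  obtain ⟨x, hx⟩ : ∃ x, χ (e x) ≠ 0 := by
    by_contra! h0
    exact hχ (WithConv.ext (hom_ext h0))
  apply Algebra.isUnit_of_isLeftRegular (k := k)
  refine isLeftRegular_of_non_zero_divisor χ fun c hc => ?_
  have h1 := convMul_mul'_comp_map χ χ c 1
  rw [hc, mul_one, h, mul_assoc, ofConv_zero, TensorProduct.map_zero_left, LinearMap.comp_zero,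
    toConv_zero, Units.mul_right_eq_zero] at h1
  refine WithConv.ext (hom_ext fun z => ?_)
  have h2 := congrArg (fun p => p (e (x * z) ⊗ₜ e x)) h1
  simp [-LinearMap.convMul_apply, convMul_tmul, translate_e, e_mul_e, counit_apply, ev_e,
    apply_ite χ.ofConv] at h2
  simpa [mul_inv_eq_iff_eq_mul, hx] using h2

theorem convMul_comp_mul' (p q : Conv1 k (FunctionHopf k G)) :
    (toConv (p.ofConv ∘ₗ mul' k (FunctionHopf k G)) *
      toConv (q.ofConv ∘ₗ mul' k (FunctionHopf k G)) : Conv2 k (FunctionHopf k G)) =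
    toConv ((p * q).ofConv ∘ₗ mul' k (FunctionHopf k G)) :=
  (WithConv.ext (convMul_comp_coalgHom_distrib p q
    (Bialgebra.mulCoalgHom k (FunctionHopf k G)))).symm

/-- Since `μ` is a coalgebra map, `η⁻¹ ∘ μ` is the convolution inverse of `η ∘ μ`. -/
theorem eq_coboundary_of_map_eq_convMul (σ : Conv2 k (FunctionHopf k G))
    (η : (Conv1 k (FunctionHopf k G))ˣ)
    (h : toConv (mul' k k ∘ₗ TensorProduct.map η.val.ofConv η.val.ofConv) =
      σ * toConv (η.val.ofConv ∘ₗ mul' k (FunctionHopf k G))) : σ = coboundary η := by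
  have h1 : toConv ((1 : Conv1 k (FunctionHopf k G)).ofConv ∘ₗ mul' k (FunctionHopf k G)) =
      (1 : Conv2 k (FunctionHopf k G)) := by
    apply WithConv.ext
    ext f g
    simp [mul_comm]
  rw [coboundary, h, mul_assoc, convMul_comp_mul', Units.mul_inv, h1, mul_one]

end FunctionHopf

/-! ### Triviality of symmetric cocycles -/

theorem corollary3p5 {k G : Type*} [Field k] [IsAlgClosed k] [CharZero k]
    [Group G] [Fintype G] [DecidableEq G]
    (α : (Conv2 k (FunctionHopf k G))ˣ)
    (hα : α ∈ Z2Lazy k (FunctionHopf k G))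
    (hsymm : ∀ g h : G, α.val (FunctionHopf.e g ⊗ₜ[k] FunctionHopf.e h) =
      α.val (FunctionHopf.e h ⊗ₜ[k] FunctionHopf.e g)) :
    IsCohomologicallyTrivial α := by
  obtain ⟨⟨hreg, hcocycle⟩, -⟩ := hα
  obtain ⟨χ, hχ1, hχ⟩ := LinearMap.exists_character_of_comm_assoc
    (FunctionHopf.twistedMul α.val) 1
    (FunctionHopf.one_twistedMul fun h => (hreg h).1)
    (FunctionHopf.twistedMul_comm hsymm)
    (FunctionHopf.twistedMul_assoc hcocycle)
  have hmap : WithConv.toConv (LinearMap.mul' k k ∘ₗ TensorProduct.map χ χ) =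
      α.val * WithConv.toConv (χ ∘ₗ LinearMap.mul' k (FunctionHopf k G)) := by
    apply WithConv.ext
    ext f g
    exact (hχ f g).symm.trans (FunctionHopf.convMul_comp_mul'_tmul χ f g).symm
  have hne : WithConv.toConv χ ≠ 0 := fun h0 => by
    rw [WithConv.toConv_eq_zero] at h0
    simp [h0] at hχ1
  obtain ⟨η, hη⟩ := FunctionHopf.isUnit_of_map_eq_convMul α _ hne hmap
  refine ⟨η, ?_, FunctionHopf.eq_coboundary_of_map_eq_convMul α.val η (by rw [hη]; exact hmap)⟩
  change η.val 1 = 1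
  rw [hη]
  exact hχ1
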